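/- All graphs are finite, simple and undirected. A hereditary graph property $\mathcal P$ is an infinite class of graphs (i.e. containing infinitely many pairwise non-isomorphic graphs) that is closed under isomorphism and under taking induced subgraphs. Let $P_n$ be the number of graphs in $\mathcal P$ with vertex set $\{1,\dots,n\}$. The entropy of $\mathcal P$ is $$h(\mathcal P)=\lim_{n\to\infty}\frac{\log_2 P_n}{\binom n2}.$$ The VC-dimension $vc[G]$ of a graph $G$ is the VC-dimension of the family of closed neighbourhoods $N[v]=N(v)\cup\{v\}$, $v\in V(G)$, i.e. the largest size of a set $A\subseteq V(G)$ such that for every $B\subseteq A$ there is a vertex $v$ with $A\cap N[v]=B$. Its version $vc(G)$ for open neighbourhoods is the largest size of a set $A\subseteq V(G)$ such that for every $B\subseteq A$ there is a vertex $v\notin A$ with $A\cap N(v)=B$. (Both are $0$ if there is no such set $A$.) Theorem. Let $\mathcal P$ be a hereditary graph property. Then the limit defining $h(\mathcal P)$ exists, and $h(\mathcal P)=0$ if and only if the VC-dimension of the graphs in $\mathcal P$ is bounded by a constant, i.e. there is a $k$ with $vc[G]\le k$ for all $G\in\mathcal P$. Likewise, $h(\mathcal P)=0$ if and only if there is a $k$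 with $vc(G)\le k$ for all $G\in\mathcal P$. -/

import Mathlib

open Filter Topology

/-- A class of finite simple graphs. -/
abbrev GraphClass : Type 1 := ∀ (V : Type) [Finite V], Set (SimpleGraph V)

namespace GraphClass

/-- A hereditary graph property: a class of finite graphs that is closed under isomorphism and
under taking induced subgraphs (`H.IsIndContained G` says that `H` is isomorphic to an induced
subgraph of `G`), and that is infinite, i.e. has infinitely many members with vertex set of the
form `{0, …, n - 1}` (equivalently, infinitely many members up to isomorphism). -/
structure IsHereditaryProperty (P : GraphClass) : Prop where
  mem_of_iso : ∀ (V W : Type) [Finite V] [Finite W] (G : SimpleGraph V) (H : SimpleGraph W),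
    Nonempty (G ≃g H) → G ∈ P V → H ∈ P W
  mem_of_isIndContained : ∀ (V W : Type) [Finite V] [Finite W]
    (G : SimpleGraph V) (H : SimpleGraph W), H.IsIndContained G → G ∈ P V → H ∈ P W
  infinite : {G : Σ n : ℕ, SimpleGraph (Fin n) | G.2 ∈ P (Fin G.1)}.Infinite

/-- The speed of `P`: the number `P_n` of labelled graphs on `n` vertices that belong to `P`. -/
noncomputable def speed (P : GraphClass) (n : ℕ) : ℕ := (P (Fin n)).ncard

/-- The number `h` is the entropy of `P`, i.e. the limit of `log₂ P_n / (n choose 2)`. -/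
def HasEntropy (P : GraphClass) (h : ℝ) : Prop :=
  Tendsto (fun n : ℕ => Real.logb 2 (P.speed n : ℝ) / (n.choose 2 : ℝ)) atTop (𝓝 h)

end GraphClass

namespace SimpleGraph

open Classical in
/-- The VC-dimension of `G`: that of the family of the closed neighbourhoods
`N[v] = N(v) ∪ {v}`. -/
noncomputable def vcDimClosed {V : Type*} [Fintype V] (G : SimpleGraph V) : ℕ :=
  (Finset.univ.image fun v : V => insert v (G.neighborFinset v)).vcDim

open Classical in
/-- The VC-dimension of `G` in terms of open neighbourhoods: the largest size of a set `A` of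
vertices such that for every `B ⊆ A` there is a vertex `v` outside of `A` with `B = A ∩ N(v)`
(and `0` if there is no such set). -/
noncomputable def vcDimOpen {V : Type*} [Fintype V] (G : SimpleGraph V) : ℕ :=
  (Finset.univ.filter fun A : Finset V =>
    ∀ B ⊆ A, ∃ v ∉ A, B = A ∩ G.neighborFinset v).sup Finset.card

end SimpleGraph

/-! View the labelled graphs of the property as a family of edge sets. Each edge on `n + 1` vertices
survives the deletion of all but two of them, so Shearer's lemma gives `speed_succ_pow_le`. Hence
the normalised logarithms decrease to a limit that bounds them all from below. If the limit is
positive, the Sauer–Shelah lemma yields a shattered set of pairs of positive density. By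
Kővári–Sós–Turán it contains a biclique with parts `k` and `2 ^ k`. All edge patterns on it are
realised, so some graph makes the small part open-shattered. Conversely, an open-shattered set of
size `2 n` produces every bipartite pattern between two `n`-sets, and `2 ^ (n ^ 2)` graphs keep the
entropy at least `1 / 2`. Both dimensions are bounded together, since `vc(G) ≤ vc[G] ≤ 2 vc(G) + 2`.
-/

namespace Finset

/-! ### Counting tools and Shearer's lemma -/

variable {α ι : Type*}

/-- The arithmetic-geometric mean inequality, in the form of a bound for a product. -/
lemma prod_le_arith_mean_pow (s : Finset ι) (z : ι → ℝ) (hz : ∀ i ∈ s, 0 ≤ z i) :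
    ∏ i ∈ s, z i ≤ ((∑ i ∈ s, z i) / #s) ^ #s := by
  rcases s.eq_empty_or_nonempty with rfl | hs
  · simp
  have hs' : (0 : ℝ) < #s := by exact_mod_cast hs.card_pos
  have h := Real.geom_mean_le_arith_mean s (fun _ => (1 : ℝ)) z (fun _ _ => zero_le_one)
    (by simpa using hs) hz
  simp only [Real.rpow_one, sum_const, nsmul_eq_mul, mul_one, one_mul] at h
  have hp : 0 ≤ ∏ i ∈ s, z i := prod_nonneg hz
  calc ∏ i ∈ s, z i = ((∏ i ∈ s, z i) ^ ((#s : ℝ)⁻¹)) ^ #s := by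
        rw [← Real.rpow_natCast, ← Real.rpow_mul hp, inv_mul_cancel₀ hs'.ne', Real.rpow_one]
    _ ≤ _ := pow_le_pow_left₀ (Real.rpow_nonneg hp _) h _

/-- Superadditivity of the geometric mean, with additional factors. -/
lemma add_pow_card_le_prod [Fintype ι] (s : Finset ι) (hs : s.Nonempty)
    (x y z : ι → ℝ) (hx : ∀ i, 0 ≤ x i) (hy : ∀ i, 0 ≤ y i) (hxz : ∀ i, x i ≤ z i)
    (hyz : ∀ i, y i ≤ z i) (hs' : ∀ i ∈ s, x i + y i ≤ z i) {X Y : ℝ} (hX : 0 ≤ X) (hY : 0 ≤ Y)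
    (hXx : X ^ #s ≤ ∏ i, x i) (hYy : Y ^ #s ≤ ∏ i, y i) :
    (X + Y) ^ #s ≤ ∏ i, z i := by
  classical
  have hk : #s ≠ 0 := hs.card_ne_zero
  have hz : ∀ i, 0 ≤ z i := fun i => (hx i).trans (hxz i)
  by_cases h0 : ∃ i, z i = 0
  · obtain ⟨i, hi⟩ := h0
    have hX0 : X = 0 := by
      rw [prod_eq_zero (mem_univ i) (le_antisymm (hi ▸ hxz i) (hx i))] at hXx
      exact (pow_eq_zero_iff hk).1 (le_antisymm hXx (by positivity))
    have hY0 : Y = 0 := by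
      rw [prod_eq_zero (mem_univ i) (le_antisymm (hi ▸ hyz i) (hy i))] at hYy
      exact (pow_eq_zero_iff hk).1 (le_antisymm hYy (by positivity))
    simp [hX0, hY0, hk, prod_nonneg fun i _ => hz i]
  push Not at h0
  have hz' : ∀ i, 0 < z i := fun i => lt_of_le_of_ne (hz i) (h0 i).symm
  set C : ℝ := (∏ i, z i) ^ ((#s : ℝ)⁻¹) with hC
  have hprod : 0 < ∏ i, z i := prod_pos fun i _ => hz' i
  have hCpos : 0 < C := Real.rpow_pos_of_pos hprod _
  have hCk : C ^ #s = ∏ i, z i := Real.rpow_inv_natCast_pow hprod.le hk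
  -- After division by `z`, factors outside `s` are at most `1` and can be dropped; the mean
  -- inequality handles those in `s`.
  have key : ∀ (w : ι → ℝ) (W : ℝ), (∀ i, 0 ≤ w i) → (∀ i, w i ≤ z i) → 0 ≤ W →
      W ^ #s ≤ ∏ i, w i → W / C ≤ (∑ i ∈ s, w i / z i) / #s := by
    intro w W hw hwz hW h
    have hsum : 0 ≤ (∑ i ∈ s, w i / z i) / #s :=
      div_nonneg (sum_nonneg fun i _ => div_nonneg (hw i) (hz i)) (Nat.cast_nonneg _)
    refine le_of_pow_le_pow_left₀ hk hsum ?_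
    calc (W / C) ^ #s ≤ (∏ i, w i) / ∏ i, z i := by rw [div_pow, hCk]; gcongr
      _ = ∏ i, w i / z i := by rw [prod_div_distrib]
      _ ≤ ∏ i ∈ s, w i / z i := by
          refine prod_le_prod_of_subset_of_le_one (subset_univ s)
            (fun i _ => div_nonneg (hw i) (hz i)) (fun i _ _ => ?_)
          exact div_le_one_of_le₀ (hwz i) (hz i)
      _ ≤ _ := prod_le_arith_mean_pow s _ fun i _ => div_nonneg (hw i) (hz i)
  have hsum : (X + Y) / C ≤ 1 := by
    calc (X + Y) / C = X / C + Y / C := add_div _ _ _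
      _ ≤ (∑ i ∈ s, x i / z i) / #s + (∑ i ∈ s, y i / z i) / #s :=
          add_le_add (key x X hx hxz hX hXx) (key y Y hy hyz hY hYy)
      _ = (∑ i ∈ s, (x i + y i) / z i) / #s := by
          rw [← add_div, ← sum_add_distrib]; simp_rw [add_div]
      _ ≤ (∑ i ∈ s, 1) / #s := by
          gcongr with i hi
          exact div_le_one_of_le₀ (hs' i hi) (hz i)
      _ = 1 := by
          have : (#s : ℝ) ≠ 0 := by exact_mod_cast hk
          simp [this]
  rw [← hCk]
  exact pow_le_pow_left₀ (by positivity) ((div_le_one hCpos).1 hsum) _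

/-- A family of subsets of `E` all of whose members have at most `t` elements has at most
`x ^ (-t) * (1 + x) ^ |E|` members, for `0 < x ≤ 1`. -/
lemma card_mul_rpow_le_one_add_pow (𝒜 : Finset (Finset α)) (E : Finset α) (hE : ∀ A ∈ 𝒜, A ⊆ E)
    {t x : ℝ} (ht : ∀ A ∈ 𝒜, (#A : ℝ) ≤ t) (hx : 0 < x) (hx1 : x ≤ 1) :
    #𝒜 * x ^ t ≤ (1 + x) ^ #E := by
  calc #𝒜 * x ^ t = ∑ A ∈ 𝒜, x ^ t := by simp
    _ ≤ ∑ A ∈ 𝒜, x ^ #A := by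
        refine sum_le_sum fun A hA => ?_
        rw [← Real.rpow_natCast]
        exact Real.rpow_le_rpow_of_exponent_ge hx hx1 (ht A hA)
    _ ≤ ∑ A ∈ E.powerset, x ^ #A :=
        sum_le_sum_of_subset_of_nonneg (fun A hA => mem_powerset.2 (hE A hA))
          fun _ _ _ => by positivity
    _ = (1 + x) ^ #E := by
        rw [add_comm, ← sum_pow_mul_eq_add_pow]; simp

/-- A relation in which every element of `W` has at least `ε * |V| + k` neighbours in `V` contains
a biclique with `k` vertices on one side and a proportion `ε ^ k` of `W` on the other. -/
lemma exists_biclique {β : Type*} [Fintype α] (r : β → α → Prop) {ε : ℝ} (hε : 0 < ε)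
    (W : Finset β) (hW : W.Nonempty) (k : ℕ) [∀ w, DecidablePred (r w)]
    (h : ∀ w ∈ W, ε * Fintype.card α + k ≤ #{u | r w u}) :
    ∃ A : Finset α, #A = k ∧ ∃ W' ⊆ W, ε ^ k * #W ≤ #W' ∧ ∀ w ∈ W', ∀ a ∈ A, r w a := by
  classical
  induction k with
  | zero => exact ⟨∅, rfl, W, Subset.rfl, by simp, by simp⟩
  | succ k ih =>
    obtain ⟨A, hA, W', hW', hcard, hr⟩ := ih fun w hw => le_trans (by push_cast; linarith) (h w hw)
    have hWpos : (0 : ℝ) < #W := by exact_mod_cast hW.card_pos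
    have hW'pos : (0 : ℝ) < #W' := lt_of_lt_of_le (by positivity) hcard
    have hdeg : ∀ w ∈ W', ε * Fintype.card α + 1 ≤ #{u ∈ Aᶜ | r w u} := by
      intro w hw
      have h1 := h w (hW' hw)
      have h2 : #{u | r w u} ≤ #{u ∈ Aᶜ | r w u} + #A := by
        refine (card_le_card fun u hu => ?_).trans (card_union_le _ _)
        have := (mem_filter.1 hu).2
        by_cases hu : u ∈ A <;> simp [hu, this]
      have h2' : (#{u | r w u} : ℝ) ≤ #{u ∈ Aᶜ | r w u} + k := by
        rw [← hA]; exact_mod_cast h2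
      push_cast at h1
      linarith
    -- Double counting; the spare `+ 1` in `hdeg` makes the contradiction strict.
    have hex : ∃ u ∈ Aᶜ, ε * #W' ≤ #{w ∈ W' | r w u} := by
      by_contra! hcon
      have h1 : ∑ w ∈ W', (#{u ∈ Aᶜ | r w u} : ℝ) = ∑ u ∈ Aᶜ, (#{w ∈ W' | r w u} : ℝ) := by
        exact_mod_cast sum_card_bipartiteAbove_eq_sum_card_bipartiteBelow r
      have h2 : #W' * (ε * Fintype.card α + 1) ≤ ∑ w ∈ W', (#{u ∈ Aᶜ | r w u} : ℝ) := by
        simpa [mul_add] using card_nsmul_le_sum W' _ _ hdeg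
      have h3 : ∑ u ∈ Aᶜ, (#{w ∈ W' | r w u} : ℝ) ≤ #(Aᶜ) * (ε * #W') := by
        simpa using sum_le_card_nsmul (Aᶜ) _ _ fun u hu => (hcon u hu).le
      have h4 : (#(Aᶜ) : ℝ) ≤ Fintype.card α := by exact_mod_cast card_le_univ _
      have h5 : (#(Aᶜ) : ℝ) * (ε * #W') ≤ Fintype.card α * (ε * #W') := by gcongr
      nlinarith
    obtain ⟨u, hu, hucard⟩ := hex
    refine ⟨insert u A, by rw [card_insert_of_notMem (mem_compl.1 hu), hA], {w ∈ W' | r w u},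
      (filter_subset _ _).trans hW', ?_, ?_⟩
    · calc ε ^ (k + 1) * #W = ε * (ε ^ k * #W) := by ring
        _ ≤ ε * #W' := by gcongr
        _ ≤ _ := hucard
    · intro w hw a ha
      rw [mem_filter] at hw
      rcases mem_insert.1 ha with rfl | ha
      · exact hw.2
      · exact hr w hw.1 a ha

variable [DecidableEq α]

/-- **Shearer's lemma** for set families: if every element of the members of `𝒜` lies in at least
`k` of the sets `S i`, then `|𝒜| ^ k` is at most the product of the sizes of the traces of `𝒜`
on the sets `S i`. -/
theorem card_pow_le_prod_card_image_inter [Fintype ι] (S : ι → Finset α) {k : ℕ} (hk : k ≠ 0)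
    (𝒜 : Finset (Finset α)) (h : ∀ A ∈ 𝒜, ∀ a ∈ A, k ≤ #{i | a ∈ S i}) :
    #𝒜 ^ k ≤ ∏ i, #(𝒜.image (· ∩ S i)) := by
  induction 𝒜 using memberFamily_induction_on with
  | empty => simp [hk]
  | singleton_empty => simp
  | @subfamily a 𝒜 ih₀ ih₁ =>
    have hcard := card_memberSubfamily_add_card_nonMemberSubfamily a 𝒜
    have ih₀ := ih₀ fun A hA b hb => h A (mem_nonMemberSubfamily.1 hA).1 b hb
    have ih₁ := ih₁ fun A hA b hb =>
      h _ (mem_memberSubfamily.1 hA).1 b (mem_insert_of_mem hb)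
    have hsub₀ : ∀ i, (𝒜.nonMemberSubfamily a).image (· ∩ S i) ⊆ 𝒜.image (· ∩ S i) :=
      fun i => image_subset_image fun A hA => (mem_nonMemberSubfamily.1 hA).1
    rcases (𝒜.memberSubfamily a).eq_empty_or_nonempty with hne | ⟨A, hA⟩
    · rw [hne, card_empty, zero_add] at hcard
      rw [← hcard]
      exact ih₀.trans (prod_le_prod' fun i _ => card_le_card (hsub₀ i))
    obtain ⟨s, hs, hsk⟩ := exists_subset_card_eq
      (h _ (mem_memberSubfamily.1 hA).1 a (mem_insert_self a A))
    -- When `a ∈ S i`, members with and without `a` have different traces, so the trace counts add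
    -- up.
    have hsum : ∀ i, a ∈ S i → #((𝒜.nonMemberSubfamily a).image (· ∩ S i)) +
        #((𝒜.memberSubfamily a).image (· ∩ S i)) ≤ #(𝒜.image (· ∩ S i)) := by
      intro i hi
      rw [← card_memberSubfamily_add_card_nonMemberSubfamily a (𝒜.image (· ∩ S i)), add_comm]
      refine add_le_add (card_le_card fun B hB => ?_) (card_le_card fun B hB => ?_)
      · obtain ⟨A, hA, rfl⟩ := mem_image.1 hB
        rw [mem_memberSubfamily] at hA ⊢
        refine ⟨mem_image.2 ⟨_, hA.1, ?_⟩, fun hm => hA.2 (mem_inter.1 hm).1⟩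
        rw [insert_inter_of_mem hi]
      · obtain ⟨A, hA, rfl⟩ := mem_image.1 hB
        rw [mem_nonMemberSubfamily] at hA ⊢
        exact ⟨mem_image_of_mem _ hA.1, fun hm => hA.2 (mem_inter.1 hm).1⟩
    have hle₁ : ∀ i, #((𝒜.memberSubfamily a).image (· ∩ S i)) ≤ #(𝒜.image (· ∩ S i)) := by
      intro i
      by_cases hi : a ∈ S i
      · exact le_trans (Nat.le_add_left _ _) (hsum i hi)
      refine card_le_card fun B hB => ?_
      obtain ⟨A, hA, rfl⟩ := mem_image.1 hB
      refine mem_image.2 ⟨_, (mem_memberSubfamily.1 hA).1, ?_⟩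
      rw [insert_inter_of_notMem hi]
    subst hsk
    have := add_pow_card_le_prod s (card_ne_zero.1 hk)
      (fun i => (#((𝒜.nonMemberSubfamily a).image (· ∩ S i)) : ℝ))
      (fun i => (#((𝒜.memberSubfamily a).image (· ∩ S i)) : ℝ))
      (fun i => (#(𝒜.image (· ∩ S i)) : ℝ)) (fun i => Nat.cast_nonneg _)
      (fun i => Nat.cast_nonneg _) (fun i => by exact_mod_cast card_le_card (hsub₀ i))
      (fun i => by exact_mod_cast hle₁ i)
      (fun i hi => by exact_mod_cast hsum i (mem_filter.1 (hs hi)).2)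
      (X := #(𝒜.nonMemberSubfamily a)) (Y := #(𝒜.memberSubfamily a))
      (Nat.cast_nonneg _) (Nat.cast_nonneg _) (by exact_mod_cast ih₀) (by exact_mod_cast ih₁)
    rw [← hcard, add_comm]
    exact_mod_cast this

end Finset

/-! ### Edge families and existence of the entropy -/

open Finset in
open scoped Classical in
/-- The family of the edge sets of the graphs in `P` with vertex set `Fin n`. -/
noncomputable def GraphClass.edgeFamily (P : GraphClass) (n : ℕ) :
    Finset (Finset (Sym2 (Fin n))) :=
  image (fun G : SimpleGraph (Fin n) => G.edgeFinset) {G | G ∈ P (Fin n)}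

namespace GraphClass

open Finset

open scoped Classical in
lemma mem_edgeFamily {P : GraphClass} {n : ℕ} {A : Finset (Sym2 (Fin n))} :
    A ∈ P.edgeFamily n ↔ ∃ G ∈ P (Fin n), G.edgeFinset = A := by
  simp [edgeFamily]

lemma card_edgeFamily (P : GraphClass) (n : ℕ) : #(P.edgeFamily n) = P.speed n := by
  classical
  rw [edgeFamily, card_image_of_injective _ fun G H h => SimpleGraph.edgeFinset_inj.1 h, speed,
    ← Set.ncard_coe_finset]
  congr 1
  ext; simp

lemma IsHereditaryProperty.comap_mem {P : GraphClass} (hP : P.IsHereditaryProperty) {V W : Type}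
    [Finite V] [Finite W] {G : SimpleGraph V} (hG : G ∈ P V) {f : W → V}
    (hf : Function.Injective f) : G.comap f ∈ P W :=
  hP.mem_of_isIndContained V W G _ ⟨SimpleGraph.Embedding.comap ⟨f, hf⟩ G⟩ hG

/-- If no member had `n` vertices, none could have more, leaving only finitely many. -/
lemma IsHereditaryProperty.one_le_speed {P : GraphClass} (hP : P.IsHereditaryProperty) (n : ℕ) :
    1 ≤ P.speed n := by
  have hne : (P (Fin n)).Nonempty := by
    by_contra hemp
    refine hP.infinite ((Set.finite_Iio n).biUnion (t := fun m =>
      Set.range fun G : SimpleGraph (Fin m) => (⟨m, G⟩ : Σ n : ℕ, SimpleGraph (Fin n)))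
      (fun m _ => Set.finite_range _) |>.subset fun ⟨m, G⟩ hG => ?_)
    refine Set.mem_biUnion (x := m) ?_ ⟨G, rfl⟩
    by_contra hmn
    exact hemp ⟨_, hP.comap_mem hG (Fin.castLE_injective (not_lt.1 hmn))⟩
  exact (Set.ncard_pos (Set.toFinite _)).2 hne

/-- Shearer's lemma for the speed of a hereditary property. -/
lemma IsHereditaryProperty.speed_succ_pow_le {P : GraphClass} (hP : P.IsHereditaryProperty)
    {n : ℕ} (hn : 2 ≤ n) : P.speed (n + 1) ^ (n - 1) ≤ P.speed n ^ (n + 1) := by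
  classical
  set S : Fin (n + 1) → Finset (Sym2 (Fin (n + 1))) := fun i => {e | i ∉ e} with hS
  have h1 := card_pow_le_prod_card_image_inter S (k := n - 1) (by lia) (P.edgeFamily (n + 1)) ?_
  · rw [card_edgeFamily] at h1
    refine h1.trans ((prod_le_pow_card _ _ (P.speed n) fun i _ => ?_).trans (by simp))
    rw [← card_edgeFamily]
    refine (card_le_card ?_).trans
      (card_image_le (s := P.edgeFamily n) (f := image (Sym2.map i.succAbove)))
    intro B hB
    obtain ⟨A, hA, rfl⟩ := mem_image.1 hB
    obtain ⟨G, hG, rfl⟩ := mem_edgeFamily.1 hA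
    refine mem_image.2 ⟨(G.comap i.succAbove).edgeFinset, mem_edgeFamily.2
      ⟨_, hP.comap_mem hG i.succAbove_right_injective, rfl⟩, ?_⟩
    ext e
    simp only [mem_image, mem_inter, SimpleGraph.mem_edgeFinset, hS, mem_filter, mem_univ,
      true_and]
    constructor
    · rintro ⟨e, he, rfl⟩
      induction e with | _ x y
      simpa [(i.succAbove_ne _).symm] using he
    · induction e with | _ x y
      rintro ⟨he, hi⟩
      simp only [Sym2.mem_iff, not_or] at hi
      obtain ⟨x, rfl⟩ := Fin.exists_succAbove_eq (Ne.symm hi.1)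
      obtain ⟨y, rfl⟩ := Fin.exists_succAbove_eq (Ne.symm hi.2)
      exact ⟨s(x, y), by simpa using he, by simp⟩
  · intro A _ e _
    induction e with | _ x y
    have hsub : univ \ {x, y} ⊆ ({i | s(x, y) ∈ S i} : Finset (Fin (n + 1))) := by
      intro i hi
      simpa [hS] using hi
    have h2 := (le_card_sdiff {x, y} (univ : Finset (Fin (n + 1)))).trans (card_le_card hsub)
    have h3 : #{x, y} ≤ 2 := card_le_two
    rw [card_univ, Fintype.card_fin] at h2
    lia

/-- This is `speed_succ_pow_le` in logarithms, because `(n + 1).choose 2 / n.choose 2 = (n + 1) / (n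
- 1)`. -/
lemma IsHereditaryProperty.antitoneOn_logb_speed_div {P : GraphClass}
    (hP : P.IsHereditaryProperty) :
    AntitoneOn (fun n : ℕ => Real.logb 2 (P.speed n : ℝ) / (n.choose 2 : ℝ)) (Set.Ici 2) := by
  refine antitoneOn_nat_Ici_of_succ_le fun n hn => ?_
  have hpos : ∀ m, (0 : ℝ) < P.speed m := fun m => by exact_mod_cast hP.one_le_speed m
  have h : (n - 1 : ℝ) * Real.logb 2 (P.speed (n + 1)) ≤ (n + 1) * Real.logb 2 (P.speed n) := by
    have h1 : ((P.speed (n + 1) : ℝ)) ^ (n - 1) ≤ (P.speed n : ℝ) ^ (n + 1) := by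
      exact_mod_cast hP.speed_succ_pow_le hn
    have h2 := Real.logb_le_logb_of_le one_lt_two (pow_pos (hpos _) _) h1
    rw [Real.logb_pow, Real.logb_pow, Nat.cast_sub (by lia)] at h2
    exact_mod_cast h2
  have hn' : (2 : ℝ) ≤ n := by exact_mod_cast hn
  rw [Nat.cast_choose_two, Nat.cast_choose_two, div_le_div_iff₀]
  · push_cast
    have := mul_le_mul_of_nonneg_left h (by positivity : (0 : ℝ) ≤ n / 2)
    linarith
  · push_cast; nlinarith
  · nlinarith

lemma IsHereditaryProperty.logb_speed_div_nonneg {P : GraphClass}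
    (hP : P.IsHereditaryProperty) (n : ℕ) :
    0 ≤ Real.logb 2 (P.speed n : ℝ) / (n.choose 2 : ℝ) :=
  div_nonneg (Real.logb_nonneg one_lt_two (by exact_mod_cast hP.one_le_speed n))
    (Nat.cast_nonneg _)

/-- The entropy of a hereditary property exists, and is approached from above. -/
theorem IsHereditaryProperty.exists_hasEntropy {P : GraphClass} (hP : P.IsHereditaryProperty) :
    ∃ h : ℝ, P.HasEntropy h ∧ 0 ≤ h ∧
      ∀ n, 2 ≤ n → h ≤ Real.logb 2 (P.speed n : ℝ) / (n.choose 2 : ℝ) := by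
  have hbdd : BddBelow
      {x | ∃ n ∈ Set.Ici 2, Real.logb 2 (P.speed n : ℝ) / (n.choose 2 : ℝ) = x} :=
    ⟨0, by rintro x ⟨n, _, rfl⟩; exact hP.logb_speed_div_nonneg n⟩
  have ht := Real.tendsto_atTop_csInf_of_antitoneOn_bddBelow_nat_Ici
    hP.antitoneOn_logb_speed_div hbdd
  exact ⟨_, ht, ge_of_tendsto' ht hP.logb_speed_div_nonneg,
    fun n hn => csInf_le hbdd ⟨n, hn, rfl⟩⟩

end GraphClass

/-! ### Open-shattered sets and the two dimensions -/

namespace SimpleGraph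

open Finset

/-- The set `A` of vertices of `G` is shattered by the open neighbourhoods of the vertices outside
of `A`. -/
def OpenShatters {V : Type*} (G : SimpleGraph V) (A : Finset V) : Prop :=
  ∀ B ⊆ A, ∃ v ∉ A, ∀ a ∈ A, G.Adj v a ↔ a ∈ B

lemma OpenShatters.mono {V : Type*} {G : SimpleGraph V} {A A' : Finset V} (h : G.OpenShatters A)
    (hA : A' ⊆ A) : G.OpenShatters A' := fun B hB =>
  let ⟨v, hv, hvB⟩ := h B (hB.trans hA)
  ⟨v, fun hm => hv (hA hm), fun a ha => hvB a (hA ha)⟩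

section

variable {V : Type*} [Fintype V] {G : SimpleGraph V}

open scoped Classical in
lemma openShatters_iff {A : Finset V} :
    G.OpenShatters A ↔ ∀ B ⊆ A, ∃ v ∉ A, B = A ∩ G.neighborFinset v := by
  refine forall₂_congr fun B hB => exists_congr fun v => and_congr_right fun _ => ?_
  simp only [Finset.ext_iff, mem_inter, mem_neighborFinset]
  exact ⟨fun h a => ⟨fun ha => ⟨hB ha, (h a (hB ha)).2 ha⟩, fun ha => (h a ha.1).1 ha.2⟩,
    fun h a ha => ⟨fun hadj => (h a).2 ⟨ha, hadj⟩, fun haB => ((h a).1 haB).2⟩⟩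

lemma OpenShatters.card_le_vcDimOpen {A : Finset V} (h : G.OpenShatters A) :
    #A ≤ G.vcDimOpen := by
  classical
  exact le_sup (f := Finset.card) (mem_filter.2 ⟨mem_univ _, openShatters_iff.1 h⟩)

lemma exists_openShatters_of_le_vcDimOpen {k : ℕ} (hk : k ≠ 0) (h : k ≤ G.vcDimOpen) :
    ∃ A, G.OpenShatters A ∧ #A = k := by
  classical
  obtain ⟨A, hA, hkA⟩ := (Finset.le_sup_iff (bot_lt_iff_ne_bot.2 hk)).1 h
  obtain ⟨A', hA', hcard⟩ := exists_subset_card_eq hkA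
  exact ⟨A', (openShatters_iff.2 (mem_filter.1 hA).2).mono hA', hcard⟩

lemma vcDimOpen_le_vcDimClosed (G : SimpleGraph V) : G.vcDimOpen ≤ G.vcDimClosed := by
  classical
  refine Finset.sup_le fun A hA => Shatters.card_le_vcDim fun B hB => ?_
  obtain ⟨v, hv, rfl⟩ := (mem_filter.1 hA).2 B hB
  exact ⟨_, mem_image_of_mem _ (mem_univ v), inter_insert_of_notMem hv⟩

/-- A set of `2 m + 1` vertices shattered by closed neighbourhoods contains a set of `m` vertices
that is shattered by the open neighbourhoods of the vertices outside of it. -/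
lemma le_vcDimOpen_of_le_vcDimClosed {m : ℕ} (h : 2 * m + 1 ≤ G.vcDimClosed) :
    m ≤ G.vcDimOpen := by
  classical
  obtain ⟨A, hA, hmA⟩ := (Finset.le_sup_iff (by simp)).1 h
  rw [mem_shatterer] at hA
  obtain ⟨A', hA', rfl⟩ := exists_subset_card_eq (s := A) (n := m) (by lia)
  refine OpenShatters.card_le_vcDimOpen fun B hB => ?_
  -- Each of the at least `m + 1` elements `c` outside `A'` tags a vertex with trace `insert c B`.
  -- The tags make these vertices distinct, so one lies outside `A'`.
  have hv : ∀ c, ∃ v, c ∈ A \ A' → ∀ a ∈ A, a ∈ insert v (G.neighborFinset v) ↔ a ∈ insert c B := by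
    intro c
    by_cases hc : c ∈ A \ A'
    · obtain ⟨u, hu, huB⟩ := hA
        (insert_subset (mem_sdiff.1 hc).1 (hB.trans hA') : insert c B ⊆ A)
      obtain ⟨v, _, rfl⟩ := mem_image.1 hu
      refine ⟨v, fun _ a ha => ?_⟩
      rw [← huB, mem_inter, and_iff_right ha]
    · exact ⟨c, fun h => absurd h hc⟩
  choose v hv using hv
  obtain ⟨c, hc, hcv⟩ : ∃ c ∈ A \ A', v c ∉ A' := by
    by_contra! hcon
    have hle := card_le_card_of_injOn v hcon fun c hc d hd hcd => by
      have h1 := (hv c hc c (mem_sdiff.1 hc).1).2 (mem_insert_self _ _)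
      rw [hcd, hv d hd c (mem_sdiff.1 hc).1] at h1
      exact (mem_insert.1 h1).resolve_right fun hm => (mem_sdiff.1 hc).2 (hB hm)
    have := card_sdiff_add_card_eq_card hA'
    lia
  refine ⟨v c, hcv, fun a ha => ?_⟩
  have h1 := hv c hc a (hA' ha)
  have hav : a ≠ v c := fun hav => hcv (hav ▸ ha)
  have hac : a ≠ c := fun hac => (mem_sdiff.1 hc).2 (hac ▸ ha)
  simpa [hav, hac] using h1

end

/-- If `G` has an open-shattered set of `2 n` vertices, then every bipartite graph with parts of
size `n` is the bipartite graph between two sets of vertices of `G`. -/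
lemma OpenShatters.exists_injective {V : Type*} {G : SimpleGraph V} {A : Finset V} {n : ℕ}
    (h : G.OpenShatters A) (hA : #A = n + n) (M : Fin n → Fin n → Prop) :
    ∃ f : Fin (n + n) → V, Function.Injective f ∧
      ∀ i j, G.Adj (f (Fin.natAdd n j)) (f (Fin.castAdd n i)) ↔ M i j := by
  classical
  let e := A.equivFinOfCardEq hA
  set a : Fin (n + n) → V := fun i => e.symm i with ha
  have hainj : Function.Injective a := Subtype.val_injective.comp e.symm.injective
  have haA : ∀ i, a i ∈ A := fun i => (e.symm i).2
  -- The second half of `A` serves as labels: `v j` sees only label `j`, which forces `v` to be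
  -- injective.
  have hv : ∀ j : Fin n, ∃ v ∉ A, ∀ x ∈ A, G.Adj v x ↔
      x ∈ ({i | M i j} : Finset (Fin n)).image (fun i => a (Fin.castAdd n i)) ∪
        {a (Fin.natAdd n j)} := fun j => h _ (by
    refine union_subset (fun x hx => ?_) (by simpa using haA _)
    obtain ⟨i, _, rfl⟩ := mem_image.1 hx
    exact haA _)
  choose v hvA hv using hv
  have hne : ∀ i j : Fin n, Fin.castAdd n i ≠ Fin.natAdd n j := fun i j hij => by
    have := congrArg Fin.val hij
    simp at this
    lia
  have hvinj : Function.Injective v := fun j j' hjj => by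
    have h1 : G.Adj (v j) (a (Fin.natAdd n j)) := (hv j _ (haA _)).2 (by simp)
    rw [hjj, hv j' _ (haA _)] at h1
    simpa [hainj.eq_iff, hne, -Fin.natAdd_eq_addNat] using h1
  refine ⟨Fin.addCases (fun i => a (Fin.castAdd n i)) v, ?_, fun i j => ?_⟩
  · intro x y
    induction x using Fin.addCases with
    | left x =>
      induction y using Fin.addCases with
      | left y => simp [hainj.eq_iff]
      | right y =>
        simp only [Fin.addCases_left, Fin.addCases_right]
        exact fun hxy => absurd (hxy ▸ haA _) (hvA y)
    | right x =>
      induction y using Fin.addCases with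
      | left y =>
        simp only [Fin.addCases_left, Fin.addCases_right]
        exact fun hxy => absurd (hxy ▸ haA _) (hvA x)
      | right y => simp [hvinj.eq_iff, -Fin.natAdd_eq_addNat]
  · simp only [Fin.addCases_left, Fin.addCases_right]
    rw [hv j _ (haA _)]
    simp [hainj.eq_iff, hne, -Fin.natAdd_eq_addNat]

end SimpleGraph

/-! ### Bicliques in dense graphs -/

namespace SimpleGraph

open Finset

open scoped Classical in
/-- A weak form of the **Kővári–Sós–Turán theorem**: large graphs of positive edge density contain
complete bipartite graphs with parts of prescribed sizes `k` and `m`. -/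
theorem eventually_exists_biclique (k m : ℕ) {δ : ℝ} (hδ : 0 < δ) :
    ∀ᶠ n : ℕ in atTop, ∀ H : SimpleGraph (Fin n), δ * n.choose 2 ≤ #H.edgeFinset →
      ∃ A W : Finset (Fin n), #A = k ∧ m ≤ #W ∧ ∀ w ∈ W, ∀ a ∈ A, H.Adj w a := by
  have ht := tendsto_natCast_atTop_atTop (R := ℝ)
  filter_upwards [eventually_gt_atTop 0,
    (ht.const_mul_atTop (by positivity : 0 < δ / 4)).eventually_ge_atTop (δ + k),
    (ht.const_mul_atTop (by positivity : 0 < (δ / 4) ^ k * (δ / 2))).eventually_ge_atTop (m : ℝ)]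
    with n hn hn1 hn2 H hH
  have hn' : (0 : ℝ) < n := by exact_mod_cast hn
  set W : Finset (Fin n) := {w | δ / 4 * n + k ≤ H.degree w} with hW
  have hsum : (∑ w, (H.degree w : ℝ)) = 2 * #H.edgeFinset := by
    exact_mod_cast H.sum_degrees_eq_twice_card_edges
  have hle : ∑ w, (H.degree w : ℝ) ≤ #W * n + n * (δ / 4 * n + k) := by
    rw [← sum_filter_add_sum_filter_not univ fun w => δ / 4 * n + k ≤ H.degree w]
    refine add_le_add ?_ ?_
    · refine (sum_le_card_nsmul _ _ (n : ℝ) fun w _ => ?_).trans_eq (nsmul_eq_mul _ _)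
      exact_mod_cast (H.degree_lt_card_verts w).le.trans_eq (Fintype.card_fin n)
    · refine (sum_le_card_nsmul _ _ (δ / 4 * n + k) fun w hw => ?_).trans ?_
      · exact (not_le.1 (mem_filter.1 hw).2).le
      · rw [nsmul_eq_mul]
        gcongr
        exact (card_le_univ _).trans_eq (Fintype.card_fin n)
  rw [Nat.cast_choose_two] at hH
  -- The average degree is at least `δ * (n - 1)`, and `hn1` absorbs the lower-order terms `δ + k`.
  have hWcard : δ / 2 * n ≤ #W := by
    have h1 : δ * (n - 1) * n ≤ (#W + (δ / 4 * n + k)) * n := by linarith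
    have h2 := le_of_mul_le_mul_right h1 hn'
    linarith
  have hWne : W.Nonempty := by
    have : (0 : ℝ) < #W := lt_of_lt_of_le (by positivity) hWcard
    exact card_pos.1 (by exact_mod_cast this)
  obtain ⟨A, hA, W', _, hW'card, hW'⟩ := exists_biclique H.Adj (by positivity : 0 < δ / 4) W hWne k
    (fun w hw => by
      rw [Fintype.card_fin, ← neighborFinset_eq_filter, card_neighborFinset_eq_degree]
      exact (mem_filter.1 hw).2)
  refine ⟨A, W', hA, ?_, hW'⟩
  have : (m : ℝ) ≤ #W' := by
    calc (m : ℝ) ≤ (δ / 4) ^ k * (δ / 2) * n := hn2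
      _ = (δ / 4) ^ k * (δ / 2 * n) := by ring
      _ ≤ (δ / 4) ^ k * #W := by gcongr
      _ ≤ _ := hW'card
  exact_mod_cast this

end SimpleGraph

/-! ### Entropy versus open-shattered sets -/

namespace GraphClass

open Finset SimpleGraph

/-- A biclique in a set of pairs that is shattered by the edge sets of the graphs in `P` yields a
graph in `P` with an open-shattered set. -/
lemma exists_openShatters_of_shatters_edgeFamily {P : GraphClass} {n : ℕ}
    {s : Finset (Sym2 (Fin n))} (hs : (P.edgeFamily n).Shatters s) {A W : Finset (Fin n)}
    (hW : 2 ^ #A ≤ #W) (h : ∀ w ∈ W, ∀ a ∈ A, s(w, a) ∈ s) :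
    ∃ G ∈ P (Fin n), G.OpenShatters A := by
  classical
  have hdisj : ∀ w ∈ W, w ∉ A := fun w hw hwA => by
    obtain ⟨t, ht, hst⟩ := hs.exists_superset
    obtain ⟨G, _, rfl⟩ := mem_edgeFamily.1 ht
    simpa using hst (h w hw w hwA)
  obtain ⟨φ⟩ : Nonempty (A.powerset ↪ W) :=
    Function.Embedding.nonempty_of_card_le (by simpa only [Fintype.card_coe, card_powerset] using hW)
  -- The prescribed pattern joins the vertex assigned to `B` to exactly `B` within `A`.
  set t : Finset (Sym2 (Fin n)) :=
    {e ∈ s | ∃ B : A.powerset, ∃ a ∈ B.1, e = s((φ B).1, a)} with ht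
  obtain ⟨E, hE, hEt⟩ := hs (filter_subset _ _ : t ⊆ s)
  obtain ⟨G, hG, rfl⟩ := mem_edgeFamily.1 hE
  refine ⟨G, hG, fun B hB => ?_⟩
  set v := φ ⟨B, mem_powerset.2 hB⟩ with hv
  refine ⟨v, hdisj _ v.2, fun a ha => ?_⟩
  have hmem : s(v.1, a) ∈ s := h _ v.2 a ha
  have h1 : G.Adj v a ↔ s(v.1, a) ∈ t := by
    rw [ht, ← hEt, mem_inter, and_iff_right hmem, mem_edgeFinset, mem_edgeSet]
  rw [h1, ht, mem_filter, and_iff_right hmem]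
  constructor
  · rintro ⟨B', a', ha', he⟩
    rcases Sym2.eq_iff.1 he with ⟨h2, rfl⟩ | ⟨-, rfl⟩
    · rw [← φ.injective (Subtype.ext h2)] at ha'
      exact ha'
    · exact absurd ha (hdisj _ (φ B').2)
  · exact fun haB => ⟨_, a, haB, rfl⟩

/-- The **Sauer–Shelah lemma** for the speed of a class of graphs. -/
lemma speed_mul_rpow_le {P : GraphClass} {n : ℕ} {t x : ℝ}
    (ht : ∀ s, (P.edgeFamily n).Shatters s → (#s : ℝ) ≤ t) (hx : 0 < x) (hx1 : x ≤ 1) :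
    P.speed n * x ^ t ≤ (1 + x) ^ n.choose 2 := by
  classical
  have hE := card_mul_rpow_le_one_add_pow (P.edgeFamily n).shatterer
    (⊤ : SimpleGraph (Fin n)).edgeFinset (fun s hs => ?_)
    (fun s hs => ht s (mem_shatterer.1 hs)) hx hx1
  · rw [card_edgeFinset_top_eq_card_choose_two, Fintype.card_fin] at hE
    refine le_trans ?_ hE
    gcongr
    rw [← card_edgeFamily]
    exact card_le_card_shatterer _
  · obtain ⟨A, hA, hsA⟩ := (mem_shatterer.1 hs).exists_superset
    obtain ⟨G, _, rfl⟩ := mem_edgeFamily.1 hA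
    exact hsA.trans (edgeFinset_mono le_top)

/-- If the entropy is positive, then the property contains graphs with arbitrarily large
open-shattered sets. -/
theorem exists_openShatters_of_logb_speed_ge {P : GraphClass} {h : ℝ} (hpos : 0 < h)
    (hspeed : ∀ n, 1 ≤ P.speed n)
    (hle : ∀ n, 2 ≤ n → h ≤ Real.logb 2 (P.speed n : ℝ) / (n.choose 2 : ℝ)) (k : ℕ) :
    ∃ n, ∃ G ∈ P (Fin n), ∃ A, G.OpenShatters A ∧ #A = k := by
  classical
  -- With `N = n.choose 2`, this gives `(1 + x) ^ N ≤ 2 ^ (h * N / 2)`; the cap `1` ensures `x ≤ 1`.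
  -- Then `δ` is chosen so that `x ^ (-δ * N) < 2 ^ (h * N / 2)`, and the product contradicts the
  -- lower bound on the speed.
  set c : ℝ := min (h / 2) 1 with hc
  have hc0 : 0 < c := lt_min (by positivity) one_pos
  obtain ⟨x, hx⟩ : ∃ x : ℝ, 1 + x = 2 ^ c := ⟨2 ^ c - 1, by ring⟩
  have hx0 : 0 < x := by
    have := Real.one_lt_rpow one_lt_two hc0
    linarith
  have hx1 : x ≤ 1 := by
    have := Real.rpow_le_rpow_of_exponent_le one_le_two (min_le_right (h / 2) 1)
    rw [← hc, ← hx, Real.rpow_one] at this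
    linarith
  set l : ℝ := -Real.logb 2 x with hl
  have hl0 : 0 ≤ l := neg_nonneg.2 (Real.logb_nonpos one_lt_two hx0.le hx1)
  set δ : ℝ := h / 2 / (l + 1) with hδ
  have hδ0 : 0 < δ := by positivity
  have hδl : δ * l < h / 2 := by
    rw [hδ, div_mul_eq_mul_div, div_lt_iff₀ (by positivity)]
    nlinarith
  obtain ⟨n, hn, hn2⟩ := ((eventually_exists_biclique k (2 ^ k) hδ0).and
    (eventually_ge_atTop 2)).exists
  have hN : (0 : ℝ) < n.choose 2 := by exact_mod_cast Nat.choose_pos hn2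
  obtain ⟨s, hs, hcard⟩ : ∃ s, (P.edgeFamily n).Shatters s ∧ δ * n.choose 2 ≤ #s := by
    by_contra! hcon
    have h1 := speed_mul_rpow_le (fun s hs => (hcon s hs).le) hx0 hx1
    have hS : (0 : ℝ) < P.speed n := by exact_mod_cast hspeed n
    have h2 := Real.logb_le_logb_of_le one_lt_two (by positivity) h1
    rw [Real.logb_mul hS.ne' (by positivity), Real.logb_rpow_eq_mul_logb_of_pos hx0,
      Real.logb_pow, hx, Real.logb_rpow two_pos (by norm_num)] at h2
    have h3 := (le_div_iff₀ hN).1 (hle n hn2)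
    have h4 : δ * l * n.choose 2 < h / 2 * n.choose 2 := by gcongr
    have h5 : n.choose 2 * c ≤ n.choose 2 * (h / 2) := by gcongr; exact min_le_left _ _
    have h6 : δ * n.choose 2 * Real.logb 2 x = -(δ * l * n.choose 2) := by rw [hl]; ring
    linarith
  have hdiag : ∀ e ∈ s, ¬ e.IsDiag := fun e he => by
    obtain ⟨t, ht, hst⟩ := hs.exists_superset
    obtain ⟨G, _, rfl⟩ := mem_edgeFamily.1 ht
    exact G.not_isDiag_of_mem_edgeFinset (hst he)
  have hedge : (fromEdgeSet (s : Set (Sym2 (Fin n)))).edgeFinset = s := by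
    ext e
    simpa [and_iff_left_iff_imp] using hdiag e
  obtain ⟨A, W, hA, hW, hadj⟩ := hn (fromEdgeSet (s : Set (Sym2 (Fin n))))
    (by convert hcard; convert hedge)
  obtain ⟨G, hG, hGA⟩ := exists_openShatters_of_shatters_edgeFamily hs (hA.symm ▸ hW)
    fun w hw a ha => (fromEdgeSet_adj _).1 (hadj w hw a ha) |>.1
  exact ⟨n, G, hG, A, hGA, hA⟩

/-- A graph with an open-shattered set of `2 n` vertices in a hereditary property forces the
property to have at least `2 ^ (n ^ 2)` labelled graphs on `2 n` vertices. -/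
lemma IsHereditaryProperty.two_pow_le_speed {P : GraphClass} (hP : P.IsHereditaryProperty)
    {V : Type} [Finite V] {G : SimpleGraph V} (hG : G ∈ P V) {A : Finset V} {n : ℕ}
    (hA : G.OpenShatters A) (hcard : #A = n + n) : 2 ^ (n * n) ≤ P.speed (n + n) := by
  classical
  have hsurj : Function.Surjective fun (H : P (Fin (n + n))) (i j : Fin n) =>
      H.1.Adj (Fin.natAdd n j) (Fin.castAdd n i) := fun M => by
    obtain ⟨f, hf, hM⟩ := hA.exists_injective hcard M
    exact ⟨⟨G.comap f, hP.comap_mem hG hf⟩, funext₂ fun i j => propext (hM i j)⟩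
  have h := Nat.card_le_card_of_surjective _ hsurj
  rw [Nat.card_coe_set_eq] at h
  simpa only [speed, Nat.card_fun, Nat.card_eq_fintype_card (α := Prop), Fintype.card_prop,
    Nat.card_fin, ← pow_mul] using h

/-- Here `n ^ 2 / (2 * n).choose 2 = n / (2 * n - 1)`, which exceeds `1 / 2`. -/
lemma IsHereditaryProperty.half_le_logb_speed_div {P : GraphClass} (hP : P.IsHereditaryProperty)
    {V : Type} [Finite V] {G : SimpleGraph V} (hG : G ∈ P V) {A : Finset V} {n : ℕ} (hn : n ≠ 0)
    (hA : G.OpenShatters A) (hcard : #A = n + n) :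
    1 / 2 ≤ Real.logb 2 (P.speed (n + n) : ℝ) / ((n + n).choose 2 : ℝ) := by
  have hn' : (1 : ℝ) ≤ n := by exact_mod_cast Nat.one_le_iff_ne_zero.2 hn
  have h1 : (2 : ℝ) ^ (n * n) ≤ P.speed (n + n) := by
    exact_mod_cast hP.two_pow_le_speed hG hA hcard
  have h2 := Real.logb_le_logb_of_le one_lt_two (by positivity) h1
  rw [Real.logb_pow, Real.logb_self_eq_one one_lt_two, mul_one] at h2
  rw [Nat.cast_choose_two, le_div_iff₀ (by push_cast; nlinarith)]
  push_cast at h2 ⊢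
  nlinarith

end GraphClass

theorem mainTheorem1 (P : GraphClass) (hP : P.IsHereditaryProperty) :
    ∃ h : ℝ, P.HasEntropy h ∧
      (h = 0 ↔ ∃ k : ℕ, ∀ (V : Type) [Fintype V], ∀ G ∈ P V, G.vcDimClosed ≤ k) ∧
      (h = 0 ↔ ∃ k : ℕ, ∀ (V : Type) [Fintype V], ∀ G ∈ P V, G.vcDimOpen ≤ k) := by
  obtain ⟨h, hent, h0, hle⟩ := hP.exists_hasEntropy
  have hopen : h = 0 ↔ ∃ k : ℕ, ∀ (V : Type) [Fintype V], ∀ G ∈ P V, G.vcDimOpen ≤ k := by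
    constructor
    · rintro rfl
      by_contra! hcon
      have hhalf : ∀ n : ℕ, n ≠ 0 →
          1 / 2 ≤ Real.logb 2 (P.speed (n + n) : ℝ) / ((n + n).choose 2 : ℝ) := fun n hn => by
        obtain ⟨V, _, G, hG, hlt⟩ := hcon (n + n)
        obtain ⟨A, hA, hcard⟩ :=
          SimpleGraph.exists_openShatters_of_le_vcDimOpen (by lia) hlt.le
        exact hP.half_le_logb_speed_div hG hn hA hcard
      have hlim := hent.comp (tendsto_atTop_mono (fun n => Nat.le_add_right n n) tendsto_id)
      have := ge_of_tendsto hlim ((eventually_ne_atTop 0).mono hhalf)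
      norm_num at this
    · rintro ⟨k, hk⟩
      by_contra hne
      obtain ⟨n, G, hG, A, hA, hcard⟩ := GraphClass.exists_openShatters_of_logb_speed_ge
        (lt_of_le_of_ne h0 (Ne.symm hne)) hP.one_le_speed hle (k + 1)
      have := hA.card_le_vcDimOpen.trans (hk _ G hG)
      lia
  refine ⟨h, hent, hopen.trans ⟨?_, ?_⟩, hopen⟩
  · rintro ⟨k, hk⟩
    refine ⟨2 * (k + 1), fun V _ G hG => ?_⟩
    by_contra! hlt
    have := (SimpleGraph.le_vcDimOpen_of_le_vcDimClosed (m := k + 1) hlt).trans (hk V G hG)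
    lia
  · rintro ⟨k, hk⟩
    exact ⟨k, fun V _ G hG => G.vcDimOpen_le_vcDimClosed.trans (hk V G hG)⟩
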